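/- Consider the spooky pebble game on the line $0\to1\to2\to\cdots$. Every node is empty, carries a pebble, or carries a ghost. The steps of an algorithm on an interval $(a,b]$ act on nodes $v\in(a,b]$ only: $\mathrm{ghost}(v)$ turns a pebble at $v$ into a ghost; $\mathrm{pebble}(v)$ puts a pebble on $v$ (replacing a ghost, if there is one) and is allowed when $v-1$ carries a pebble; $\mathrm{remove}(v)$ removes a pebble from $v$ and is allowed when $v-1$ carries a pebble. The number of pebbles used is the maximum, over all configurations that occur, of the number of pebbles on $(a,b]$ (ghosts are not counted). A sequence of steps spooky pebbles $(a,b]$ if it starts with a pebble at $a$ only and ends with pebbles at $a$ and $b$ only, without ghosts; it spooky unpebbles $(a,b]$ if it starts with pebbles at $a$ and $b$ only and ends with a pebble at $a$ only, without ghosts. Let $T(n,s)$ be the minimum number of steps needed to spooky pebble a line of length $n$ using at most $s+2$ pebbles, let $T_u(n,s)$ be the minimum number of steps needed to spooky unpebble it using at most $s+1$ pebbles, and let $B^{-1}(n,s)$ be the least $z\in\mathbb N$ with $n\le\binom{s+z}{z}$. Let $U((a,a+n],s)$, for $n,s\ge1$, be the following algorithm. If $n=1$: $\mathrm{remove}(a+1)$.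 If $s=1$ and $n=2$: $\mathrm{pebble}(a+1)$, $\mathrm{remove}(a+2)$, $\mathrm{remove}(a+1)$. If $s=1$ and $n\ge3$: $\mathrm{ghost}(a+n)$; $\mathrm{pebble}(a+1)$; for $i=a+1,\dots,a+n-2$ do $\mathrm{pebble}(i+1)$, $\mathrm{ghost}(i)$; $\mathrm{pebble}(a+n)$; $\mathrm{remove}(a+n)$; run $U((a,a+n-1],1)$. If $s,n\ge2$: let $m=B^{-1}(n,s)$, $z=\binom{s+m}{m}-n$, and $k=\max\left(\binom{s+m-2}{m-2},\binom{s+m-1}{m-1}-z\right)$, but $k=1$ if $m=1$; do $\mathrm{pebble}(a+1)$; for $i=a+1,\dots,a+k-1$ do $\mathrm{pebble}(i+1)$, $\mathrm{ghost}(i)$; run $U((a+k,a+n],s-1)$; run $U((a,a+k],s)$. Let $P((a,a+n],s)$ be obtained from $U((a,a+n],s)$ by replacing the last $\mathrm{remove}(a+n)$ with $\mathrm{pebble}(a+n)$ and skipping all other steps at $a+n$. Then the following hold, with absolute positive constants $c,c',C,K$. 1. If $n=\binom{m+s}{m}$ for some $m\in\mathbb N$, then $T(n,s)\ge c\,n\,B^{-1}(n,s)$.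 2. $T(n,s)=\Theta(n\,B^{-1}(n,s))$: for all $n\ge2$ and $s\ge1$, $c'\,n\,B^{-1}(n,s)\le T(n,s)\le C\,n\,B^{-1}(n,s)$. 3. The algorithms are correct and asymptotically optimal: for all $a\ge0$, $n\ge1$ and $s\ge1$, $U((a,a+n],s)$ spooky unpebbles $(a,a+n]$ using at most $s+1$ pebbles, in at most $K\,T_u(n,s)$ steps, and $P((a,a+n],s)$ spooky pebbles $(a,a+n]$ using at most $s+2$ pebbles, in at most $K\,T(n,s)$ steps. -/

import Mathlib

namespace SpookyPebble

/-- The content of a node of the line. -/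
inductive Cell where
  | empty
  | pebble
  | ghost
  deriving DecidableEq

/-- The three instructions of the spooky pebble game, at a node of the line. -/
inductive Move where
  | ghost (v : ℕ)
  | pebble (v : ℕ)
  | remove (v : ℕ)
  deriving DecidableEq

/-- The node that an instruction acts on. -/
def Move.node : Move → ℕ
  | .ghost v => v
  | .pebble v => v
  | .remove v => v

/-- A configuration of the line `0 → 1 → 2 → ⋯`. -/
abbrev Config := ℕ → Cell

/-- The configuration with pebbles exactly on the nodes of `S` and no ghosts. -/
def pebblesOn (S : Finset ℕ) : Config := fun i => if i ∈ S then .pebble else .empty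

/-- Legality of an instruction of an algorithm on the interval `(a, b]`. Only nodes of `(a, b]` are
acted on. A pebble may be turned into a ghost at any time; a pebble may be added (possibly over a
ghost), or removed, when the only in-node `v - 1` of `v` carries a pebble. -/
def Legal (a b : ℕ) (c : Config) : Move → Prop
  | .ghost v => (a < v ∧ v ≤ b) ∧ c v = .pebble
  | .pebble v => (a < v ∧ v ≤ b) ∧ c (v - 1) = .pebble ∧ c v ≠ .pebble
  | .remove v => (a < v ∧ v ≤ b) ∧ c (v - 1) = .pebble ∧ c v = .pebble

/-- The effect of an instruction. -/
def exec (c : Config) : Move → Config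
  | .ghost v => Function.update c v .ghost
  | .pebble v => Function.update c v .pebble
  | .remove v => Function.update c v .empty

/-- Number of pebbles on the interval `(a, b]`. -/
def pebbleCount (a b : ℕ) (c : Config) : ℕ :=
  ((Finset.Ioc a b).filter fun i => c i = .pebble).card

/-- `Runs a b p c A d`: the sequence of instructions `A` is legal on `(a, b]` from configuration `c`,
leads to configuration `d`, and every configuration on the way (the first and last included) has at
most `p` pebbles on `(a, b]`. -/
def Runs (a b p : ℕ) : Config → List Move → Config → Prop
  | c, [], d => pebbleCount a b c ≤ p ∧ c = d
  | c, mv :: A, d => pebbleCount a b c ≤ p ∧ Legal a b c mv ∧ Runs a b p (exec c mv) A d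

/-- `A` spooky pebbles `(a, b]` using at most `p` pebbles: it starts with a pebble at `a` only and
ends with pebbles at `a` and `b` only, without ghosts. -/
def Pebbles (a b p : ℕ) (A : List Move) : Prop :=
  Runs a b p (pebblesOn {a}) A (pebblesOn {a, b})

/-- `A` spooky unpebbles `(a, b]` using at most `p` pebbles: it starts with pebbles at `a` and `b`
only and ends with a pebble at `a` only, without ghosts. -/
def Unpebbles (a b p : ℕ) (A : List Move) : Prop :=
  Runs a b p (pebblesOn {a, b}) A (pebblesOn {a})

/-- `T(n, s)`: the least number of steps that spooky pebble a line of length `n` using at most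
`s + 2` pebbles. -/
noncomputable def minPebbleSteps (n s : ℕ) : ℕ :=
  sInf {t | ∃ A : List Move, Pebbles 0 n (s + 2) A ∧ A.length = t}

/-- The least number of steps that spooky unpebble a line of length `n` using at most
`s + 1` pebbles. -/
noncomputable def minUnpebbleSteps (n s : ℕ) : ℕ :=
  sInf {t | ∃ A : List Move, Unpebbles 0 n (s + 1) A ∧ A.length = t}

/-- `B⁻¹(x, y)`: the least `z` such that `x ≤ binom (y + z) z`. -/
noncomputable def invBinom (x y : ℕ) : ℕ := sInf {z | x ≤ (y + z).choose z}

/-- Starting from a pebble at `a`, bring a pebble to `a + k` (for `1 ≤ k`), leaving ghosts on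
`(a, a + k)`. -/
def sweep (a k : ℕ) : List Move :=
  .pebble (a + 1) ::
    (List.range (k - 1)).flatMap fun i => [.pebble (a + i + 2), .ghost (a + i + 1)]

/-- The quadratic-time unpebbling algorithm on `(a, a + n]`, which uses two pebbles. -/
def quadUnpebble (a : ℕ) : ℕ → List Move
  | 0 => []
  | 1 => [.remove (a + 1)]
  | 2 => [.pebble (a + 1), .remove (a + 2), .remove (a + 1)]
  | n + 3 =>
    .ghost (a + n + 3) :: sweep a (n + 2) ++
      [.pebble (a + n + 3), .remove (a + n + 3)] ++ quadUnpebble a (n + 2)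

/-- The position (relative to the left end) of the first checkpoint on a line of length `n`: with
`m = B⁻¹(n, s)` and `z = binom (s + m) m - n` it is
`max (binom (s + m - 2) (m - 2)) (binom (s + m - 1) (m - 1) - z)`, and it is `1` when `m ≤ 1`. -/
noncomputable def checkpoint (n s : ℕ) : ℕ :=
  let m := invBinom n s
  let z := (s + m).choose m - n
  if m ≤ 1 then 1
  else max ((s + m - 2).choose (m - 2)) ((s + m - 1).choose (m - 1) - z)

theorem checkpoint_lt {n s : ℕ} (hn : 1 < n) : checkpoint n s < n := by
  unfold checkpoint
  by_cases hm : invBinom n s ≤ 1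
  · simp [hm, hn]
  · have h : (s + invBinom n s - 1).choose (invBinom n s - 1) < n := by
      have h1 : invBinom n s - 1 < sInf {z | n ≤ (s + z).choose z} := by
        change invBinom n s - 1 < invBinom n s
        omega
      have h2 : ¬ n ≤ (s + (invBinom n s - 1)).choose (invBinom n s - 1) :=
        Nat.notMem_of_lt_sInf (s := {z | n ≤ (s + z).choose z}) h1
      rw [show s + invBinom n s - 1 = s + (invBinom n s - 1) by omega]
      omega
    have h3 : (s + invBinom n s - 2).choose (invBinom n s - 2) ≤
        (s + invBinom n s - 1).choose (invBinom n s - 1) := by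
      have h4 := Nat.choose_succ_succ (s + invBinom n s - 2) (invBinom n s - 2)
      have e1 : (s + invBinom n s - 2).succ = s + invBinom n s - 1 := by omega
      have e2 : (invBinom n s - 2).succ = invBinom n s - 1 := by omega
      rw [e1, e2] at h4
      omega
    simp only [hm, if_false]
    omega

/-- The unpebbling algorithm on `(a, a + n]` with parameter `s`: bring a pebble to the first
checkpoint `a + k`, unpebble `(a + k, a + n]` recursively with parameter `s - 1`, then unpebble
`(a, a + k]` recursively with parameter `s`. -/
noncomputable def optUnpebble (a n s : ℕ) : List Move :=
  if n ≤ 1 ∨ s ≤ 1 then quadUnpebble a n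
  else
    sweep a (checkpoint n s) ++
      optUnpebble (a + checkpoint n s) (n - checkpoint n s) (s - 1) ++
      optUnpebble a (checkpoint n s) s
termination_by (s, n)
decreasing_by
  · exact Prod.Lex.left _ _ (by omega)
  · exact Prod.Lex.right _ (checkpoint_lt (by omega))

/-- Conversion of an unpebbling algorithm for an interval with right end `b` into a pebbling
algorithm: the last removal of a pebble at `b` becomes the placement of a pebble at `b`, and all
other instructions at `b` are skipped. -/
def toPebbling (b : ℕ) : List Move → List Move
  | [] => []
  | mv :: A =>
    if mv.node = b then
      if mv = .remove b ∧ .remove b ∉ A then .pebble b :: toPebbling b A else toPebbling b A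
    else mv :: toPebbling b A

/-- The pebbling algorithm on `(a, a + n]` with parameter `s` obtained from `optUnpebble`. -/
noncomputable def optPebble (a n s : ℕ) : List Move := toPebbling (a + n) (optUnpebble a n s)

end SpookyPebble

/-! Lower bound. After the last placement on the right end of a line of length `n + 1`, that pebble
stays, so the first `n` nodes must be cleared of pebbles and ghosts with `s + 1` pebbles. Clearing
`v` needs pebbles on `v` and `v - 1`, so the final clearings go from right to left. By
`card_visits_le`, clearing an interval with `p + 1` pebbles leaves fewer than `2 * (t + (p +
1)).choose p` nodes visited at most `t` times. For the induction, take the longest prefix `(a, z]`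
all of whose nodes are visited before `z` is finally cleared. The prefix must be cleared again from
that moment, with one visit of each node already spent, so `t` drops. By maximality of `z`, some
pebble stays on `(a, z + 1]` while the nodes beyond `z + 1` are cleared, so there `p` drops.
Pascal's rule adds the two bounds.

With `t` about `B⁻¹(n, s) / 8` the rarely visited nodes are at most half the line, and each step
makes at most one visit, so the number of steps is of order `n * B⁻¹(n, s)`.

Upper bound. The checkpoint is chosen by Pascal's rule so that `B⁻¹` drops by one on the left part
and does not grow on the right part, where `s` drops. As the sweep costs less than two steps per
node on the left, induction gives the length bound `n * (2 * B⁻¹(n, s) + 1)`. A pebbling arises from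
an unpebbling by editing the moves at the right end, at the cost of one pebble and no steps; hence
the lower bound for pebbling also bounds unpebbling. -/

namespace SpookyPebble

/-! ### Clearing an interval: few nodes are visited rarely -/

/-- The number of times in `[i, j)` at which a pebble is put on `v` along the trajectory `σ`. -/
def visits (σ : ℕ → Config) (i j v : ℕ) : ℕ :=
  ((Finset.Ico i j).filter fun k => σ k v ≠ .pebble ∧ σ (k + 1) v = .pebble).card

theorem visits_pos {σ : ℕ → Config} {i j k v : ℕ} (hi : i ≤ k) (hj : k < j)
    (h1 : σ k v ≠ .pebble) (h2 : σ (k + 1) v = .pebble) : 0 < visits σ i j v :=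
  Finset.card_pos.2 ⟨k, by simp [hi, hj, h1, h2]⟩

theorem visits_mono {σ : ℕ → Config} {i i' j j' v : ℕ} (hi : i' ≤ i) (hj : j ≤ j') :
    visits σ i j v ≤ visits σ i' j' v :=
  Finset.card_le_card (Finset.filter_subset_filter _ (Finset.Ico_subset_Ico hi hj))

theorem visits_add {σ : ℕ → Config} {i j k v : ℕ} (hi : i ≤ j) (hj : j ≤ k) :
    visits σ i j v + visits σ j k v = visits σ i k v := by
  unfold visits
  rw [← Finset.Ico_union_Ico_eq_Ico hi hj, Finset.filter_union, Finset.card_union_of_disjoint]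
  exact Finset.disjoint_filter_filter (Finset.Ico_disjoint_Ico_consecutive i j k)

/-- A switch of a decidable predicate from false to true. -/
theorem exists_switch {P : ℕ → Prop} {i j : ℕ} (hij : i ≤ j) (hi : ¬ P i) (hj : P j) :
    ∃ k, i ≤ k ∧ k < j ∧ ¬ P k ∧ P (k + 1) := by
  induction j, hij using Nat.le_induction with
  | base => exact absurd hj hi
  | succ j hij ih =>
    by_cases h : P j
    · obtain ⟨k, h1, h2, h3⟩ := ih h
      exact ⟨k, h1, by omega, h3⟩
    · exact ⟨j, hij, by omega, h, hj⟩

/-- Pebbles are placed on `(a, b]` within the time window `[i, j]` as the game allows, where `a`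
counts as pebbled. -/
def PlacesLegally (σ : ℕ → Config) (a b i j : ℕ) : Prop :=
  ∀ k, i ≤ k → k < j → ∀ v, a + 1 < v → v ≤ b →
    σ k v ≠ .pebble → σ (k + 1) v = .pebble → σ k (v - 1) = .pebble

/-- If there is no pebble on `(a, v]` at time `i` and one on `v` at time `j`, then every node of
`(a, v]` has been pebbled in between. -/
theorem visits_pos_of_reached {σ : ℕ → Config} {a b i : ℕ} {v : ℕ} (hv : v ≤ b) :
    ∀ {j : ℕ}, PlacesLegally σ a b i j → i ≤ j → (∀ u, a < u → u ≤ v → σ i u ≠ .pebble) →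
      σ j v = .pebble → ∀ u, a < u → u ≤ v → 0 < visits σ i j u := by
  induction v with
  | zero => intros; omega
  | succ v ih =>
    intro j hp hij h0 hj u hu huv
    obtain ⟨k, h1, h2, h3, h4⟩ :=
      exists_switch (P := fun k => σ k (v + 1) = .pebble) hij (h0 _ (by omega) le_rfl) hj
    rcases Nat.eq_or_lt_of_le huv with rfl | huv
    · exact visits_pos h1 h2 h3 h4
    · have h5 := hp k h1 h2 (v + 1) (by omega) hv h3 h4
      exact (ih (by omega) (j := k) (fun k' a1 a2 => hp k' a1 (by omega)) h1
        (fun u h h' => h0 u h (by omega)) h5 u hu (by omega)).trans_le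
        (visits_mono le_rfl h2.le)

/-- The trajectory `σ` clears the interval `(a, b]` within the time window `[i, j]`, using at most
`p` pebbles. The first configuration is arbitrary, but `b` is not yet cleared. -/
structure Clears (σ : ℕ → Config) (a b i j p : ℕ) : Prop where
  place : PlacesLegally σ a b i j
  clear : ∀ k, i ≤ k → k < j → ∀ v, a < v → v ≤ b → σ k v ≠ .empty → σ (k + 1) v = .empty →
    σ k v = .pebble ∧ (a + 1 < v → σ k (v - 1) = .pebble)
  count : ∀ k, i ≤ k → k ≤ j → pebbleCount a b (σ k) ≤ p
  final : ∀ v, a < v → v ≤ b → σ j v = .empty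
  start : a < b → ∃ k, i ≤ k ∧ k ≤ j ∧ σ k b ≠ .empty

/-- The last time up to `j` at which `v` is not empty. -/
def lastNonempty (σ : ℕ → Config) (j v : ℕ) : ℕ := Nat.findGreatest (fun k => σ k v ≠ .empty) j

theorem le_lastNonempty {σ : ℕ → Config} {j v k : ℕ} (hk : k ≤ j) (h : σ k v ≠ .empty) :
    k ≤ lastNonempty σ j v :=
  Nat.le_findGreatest (P := fun k => σ k v ≠ .empty) hk h

theorem eq_empty_of_lastNonempty_lt {σ : ℕ → Config} {j v k : ℕ} (h : lastNonempty σ j v < k)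
    (hk : k ≤ j) : σ k v = .empty := by
  by_contra h'
  exact absurd (le_lastNonempty hk h') (by omega)

namespace Clears

variable {σ : ℕ → Config} {a b i j p : ℕ}

theorem lastNonempty_spec_of_ne (h : Clears σ a b i j p) {v k : ℕ} (hv : a < v) (hvb : v ≤ b)
    (hik : i ≤ k) (hkj : k ≤ j) (hk : σ k v ≠ .empty) :
    i ≤ lastNonempty σ j v ∧ lastNonempty σ j v < j ∧ σ (lastNonempty σ j v) v = .pebble ∧
      (a + 1 < v → σ (lastNonempty σ j v) (v - 1) = .pebble) := by
  have h1 : σ (lastNonempty σ j v) v ≠ .empty :=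
    Nat.findGreatest_spec (P := fun k => σ k v ≠ .empty) hkj hk
  have h2 := le_lastNonempty hkj hk
  have h3 : lastNonempty σ j v ≤ j := Nat.findGreatest_le j
  have h4 : lastNonempty σ j v ≠ j := fun e => h1 (by rw [e]; exact h.final v hv hvb)
  have h5 := h.clear _ (hik.trans h2) (by omega) v hv hvb h1
    (eq_empty_of_lastNonempty_lt (Nat.lt_succ_self _) (by omega))
  exact ⟨by omega, by omega, h5⟩

/-- The final clearing of `v + 1` needs a pebble on `v`, so nonemptiness propagates from `b` down to
every node of the interval. -/
theorem lastNonempty_spec (h : Clears σ a b i j p) {v : ℕ} (hv : a < v) (hvb : v ≤ b) :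
    i ≤ lastNonempty σ j v ∧ lastNonempty σ j v < j ∧ σ (lastNonempty σ j v) v = .pebble ∧
      (a + 1 < v → σ (lastNonempty σ j v) (v - 1) = .pebble) := by
  induction hvb using Nat.decreasingInduction with
  | self =>
    obtain ⟨k, h1, h2, h3⟩ := h.start hv
    exact h.lastNonempty_spec_of_ne hv le_rfl h1 h2 h3
  | of_succ v hvb ih =>
    obtain ⟨h1, h2, -, h3⟩ := ih (by omega)
    have h4 := h3 (by omega)
    simp only [Nat.add_sub_cancel] at h4
    exact h.lastNonempty_spec_of_ne hv hvb.le h1 h2.le (by simp [h4])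

theorem lastNonempty_succ_le (h : Clears σ a b i j p) {v : ℕ} (hv : a < v) (hvb : v < b) :
    σ (lastNonempty σ j (v + 1)) v = .pebble ∧
      lastNonempty σ j (v + 1) ≤ lastNonempty σ j v := by
  obtain ⟨-, h2, -, h3⟩ := h.lastNonempty_spec (v := v + 1) (by omega) hvb
  have h4 := h3 (by omega)
  simp only [Nat.add_sub_cancel] at h4
  exact ⟨h4, le_lastNonempty h2.le (by simp [h4])⟩

theorem lastNonempty_antitone (h : Clears σ a b i j p) {u v : ℕ} (hu : a < u) (huv : u ≤ v)
    (hvb : v ≤ b) : lastNonempty σ j v ≤ lastNonempty σ j u := by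
  induction v, huv using Nat.le_induction with
  | base => exact le_rfl
  | succ v huv ih => exact (h.lastNonempty_succ_le (by omega) hvb).2.trans (ih (by omega))

/-- The left part of the interval, from the last time at which its right end is pebbled. -/
theorem left (h : Clears σ a b i j p) {z : ℕ} (hz : a < z) (hzb : z ≤ b) :
    Clears σ a z (lastNonempty σ j z) j p where
  place k h1 h2 v h3 h4 := h.place k ((h.lastNonempty_spec hz hzb).1.trans h1) h2 v h3 (by omega)
  clear k h1 h2 v h3 h4 :=
    h.clear k ((h.lastNonempty_spec hz hzb).1.trans h1) h2 v h3 (by omega)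
  count k h1 h2 := by
    refine le_trans (Finset.card_le_card ?_) (h.count k ((h.lastNonempty_spec hz hzb).1.trans h1) h2)
    exact Finset.filter_subset_filter _ (Finset.Ioc_subset_Ioc_right hzb)
  final v h1 h2 := h.final v h1 (by omega)
  start _ := ⟨_, le_rfl, (h.lastNonempty_spec hz hzb).2.1.le, by
    simp [(h.lastNonempty_spec hz hzb).2.2.1]⟩

theorem pebbleCount_add (a z b : ℕ) (h1 : a ≤ z) (h2 : z ≤ b) (c : Config) :
    pebbleCount a z c + pebbleCount z b c = pebbleCount a b c := by
  unfold pebbleCount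
  rw [← Finset.Ioc_union_Ioc_eq_Ioc h1 h2, Finset.filter_union, Finset.card_union_of_disjoint]
  exact Finset.disjoint_filter_filter (Finset.Ioc_disjoint_Ioc_of_le le_rfl)

/-- The right part of the interval, if a pebble stays on `(a, z]` until `z + 1` is cleared. -/
theorem right (h : Clears σ a b i j (p + 1)) {z : ℕ} (hz : a < z) (hzb : z < b)
    (hstay : ∀ k, i ≤ k → k ≤ lastNonempty σ j (z + 1) → ∃ u, a < u ∧ u ≤ z ∧ σ k u = .pebble) :
    Clears σ z b i (lastNonempty σ j (z + 1) + 1) p := by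
  obtain ⟨s1, s2, s3, s4⟩ := h.lastNonempty_spec (v := z + 1) (by omega) hzb
  have hend : ∀ v, z < v → v ≤ b → σ (lastNonempty σ j (z + 1) + 1) v = .empty := by
    intro v h1 h2
    have := h.lastNonempty_antitone (u := z + 1) (by omega) h1 h2
    exact eq_empty_of_lastNonempty_lt (Nat.lt_succ_of_le this) (by omega)
  refine ⟨?_, ?_, ?_, hend, fun _ => ?_⟩
  · exact fun k h1 h2 v h3 h4 => h.place k h1 (by omega) v (by omega) h4
  · intro k h1 h2 v h3 h4 h5 h6
    have := h.clear k h1 (by omega) v (by omega) h4 h5 h6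
    exact ⟨this.1, fun _ => this.2 (by omega)⟩
  · intro k h1 h2
    -- `hstay` does not reach the final time of the window, but `(z, b]` is empty then.
    rcases Nat.eq_or_lt_of_le h2 with rfl | h2
    · have : pebbleCount z b (σ (lastNonempty σ j (z + 1) + 1)) = 0 := by
        refine Finset.card_eq_zero.2 (Finset.filter_eq_empty_iff.2 fun v hv => ?_)
        rw [Finset.mem_Ioc] at hv
        simp [hend v hv.1 hv.2]
      omega
    · obtain ⟨u, hu1, hu2, hu3⟩ := hstay k h1 (by omega)
      have h5 : 0 < pebbleCount a z (σ k) := Finset.card_pos.2 ⟨u, by simp [hu1, hu2, hu3]⟩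
      have h6 := pebbleCount_add a z b (by omega) hzb.le (σ k)
      have h7 := h.count k h1 (by omega)
      omega
  · obtain ⟨b1, b2, b3, -⟩ := h.lastNonempty_spec (v := b) (by omega) le_rfl
    have := h.lastNonempty_antitone (u := z + 1) (by omega) hzb le_rfl
    exact ⟨_, b1, by omega, by simp [b3]⟩

/-- An unvisited node carries a pebble when it is last nonempty, so it carried one already at time
`i`, where the pebble bound applies. -/
theorem card_le_of_visits_zero (h : Clears σ a b i j p) :
    ((Finset.Ioc a b).filter fun v => visits σ i j v ≤ 0).card ≤ p := by
  rcases le_or_gt b a with hab | hab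
  · simp [Finset.Ioc_eq_empty_of_le hab]
  obtain ⟨b1, b2, -⟩ := h.lastNonempty_spec hab le_rfl
  refine le_trans (Finset.card_le_card fun v hv => ?_) (h.count i le_rfl (by omega))
  simp only [Finset.mem_filter, Finset.mem_Ioc] at hv ⊢
  refine ⟨hv.1, ?_⟩
  by_contra hne
  obtain ⟨s1, s2, s3, -⟩ := h.lastNonempty_spec hv.1.1 hv.1.2
  obtain ⟨k, h1, h2, h3, h4⟩ := exists_switch (P := fun k => σ k v = .pebble) s1 hne s3
  have := visits_pos (σ := σ) (j := j) h1 (by omega) h3 h4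
  omega

/-- If `b` were beyond `a + 1`, its final clearing would need two pebbles in the interval at once.
-/
theorem le_succ_of_one (h : Clears σ a b i j 1) : b ≤ a + 1 := by
  by_contra hab
  obtain ⟨s1, s2, s3, s4⟩ := h.lastNonempty_spec (v := b) (by omega) le_rfl
  have h5 := h.count _ s1 s2.le
  have h6 : ({b - 1, b} : Finset ℕ) ⊆
      (Finset.Ioc a b).filter fun u => σ (lastNonempty σ j b) u = .pebble := by
    intro u hu
    simp only [Finset.mem_insert, Finset.mem_singleton] at hu
    rcases hu with rfl | rfl
    · simp only [Finset.mem_filter, Finset.mem_Ioc]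
      exact ⟨by omega, s4 (by omega)⟩
    · simp only [Finset.mem_filter, Finset.mem_Ioc]
      exact ⟨by omega, s3⟩
  have h7 := Finset.card_le_card h6
  rw [Finset.card_pair (by omega)] at h7
  exact absurd (h7.trans h5) (by norm_num)

/-- Few nodes are visited rarely when an interval is cleared. -/
theorem card_visits_le (t p : ℕ) : ∀ {a b i j : ℕ}, Clears σ a b i j (p + 1) →
    ((Finset.Ioc a b).filter fun v => visits σ i j v ≤ t).card + 1 ≤
      2 * (t + (p + 1)).choose p := by
  induction p generalizing t with
  | zero =>
    intro a b i j h
    have h1 := Finset.card_filter_le (Finset.Ioc a b) fun v => visits σ i j v ≤ t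
    have h2 := h.le_succ_of_one
    rw [Nat.card_Ioc] at h1
    simp only [Nat.choose_zero_right]
    omega
  | succ p ihp =>
    induction t with
    | zero =>
      intro a b i j h
      have h1 := h.card_le_of_visits_zero
      rw [zero_add, Nat.choose_succ_self_right]
      omega
    | succ t iht =>
      intro a b i j h
      have pascal : (t + 1 + (p + 1 + 1)).choose (p + 1) =
          (t + 1 + (p + 1)).choose p + (t + (p + 1 + 1)).choose (p + 1) := by
        rw [show t + 1 + (p + 1 + 1) = (t + 1 + (p + 1)) + 1 by ring, Nat.choose_succ_succ,
          show t + 1 + (p + 1) = t + (p + 1 + 1) by ring]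
      have pos : 1 ≤ (t + 1 + (p + 1)).choose p := Nat.choose_pos (by omega)
      have pos' : 1 ≤ (t + (p + 1 + 1)).choose (p + 1) := Nat.choose_pos (by omega)
      -- every node of `(a, z]` is visited before `z` is cleared, for as large a `z` as possible
      let Q : ℕ → Prop := fun z => a ≤ z ∧
        ∀ u, a < u → u ≤ z → 0 < visits σ i (lastNonempty σ j z) u
      classical
      rcases le_or_gt b a with hab | hab
      · simp only [Finset.Ioc_eq_empty_of_le hab, Finset.filter_empty, Finset.card_empty]
        omega
      -- Vacuous, whatever time is attached to `a` itself; the prefix may be empty.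
      have hQa : Q a := ⟨le_rfl, fun u h1 h2 => absurd h1 (by omega)⟩
      obtain ⟨z, hzb, ⟨haz, hz⟩, hmax⟩ : ∃ z ≤ b, Q z ∧ ∀ y, z < y → y ≤ b → ¬ Q y :=
        ⟨Nat.findGreatest Q b, Nat.findGreatest_le b, Nat.findGreatest_spec hab.le hQa,
          fun y h1 h2 => Nat.findGreatest_is_greatest h1 h2⟩
      have hleft : ((Finset.Ioc a z).filter fun v => visits σ i j v ≤ t + 1).card + 1 ≤
          2 * (t + (p + 1 + 1)).choose (p + 1) := by
        rcases Nat.eq_or_lt_of_le haz with rfl | haz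
        · simp only [Finset.Ioc_self, Finset.filter_empty, Finset.card_empty]
          omega
        · refine le_trans ?_ (iht (h.left haz hzb))
          refine Nat.succ_le_succ (Finset.card_le_card fun v hv => ?_)
          simp only [Finset.mem_filter, Finset.mem_Ioc] at hv ⊢
          obtain ⟨hv, hvt⟩ := hv
          refine ⟨hv, ?_⟩
          -- At least one visit falls before the final clearing of `z`, so at most `t` remain for
          -- the later window.
          obtain ⟨s1, s2, -⟩ := h.lastNonempty_spec haz hzb
          have h1 := visits_add (σ := σ) (v := v) s1 s2.le
          have h2 := hz v hv.1 hv.2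
          omega
      have hright : ((Finset.Ioc (z + 1) b).filter fun v => visits σ i j v ≤ t + 1).card + 1 ≤
          2 * (t + 1 + (p + 1)).choose p := by
        rcases le_or_gt b (z + 1) with hzb' | hzb'
        · simp only [Finset.Ioc_eq_empty_of_le hzb', Finset.filter_empty, Finset.card_empty]
          omega
        · obtain ⟨s1, s2, -⟩ := h.lastNonempty_spec (v := z + 1 + 1) (by omega) hzb'
          have hl := h.lastNonempty_succ_le (v := z + 1) (by omega) hzb'
          refine le_trans ?_ (ihp (t + 1) (h.right (z := z + 1) (by omega) hzb' ?_))
          · refine Nat.succ_le_succ (Finset.card_le_card fun v hv => ?_)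
            rw [Finset.mem_filter] at hv ⊢
            exact ⟨hv.1, (visits_mono le_rfl (by omega)).trans hv.2⟩
          · intro k hk1 hk2
            -- Were `(a, z + 1]` free of pebbles at time `k`, all of it would be visited before `z +
            -- 2` is finally cleared, since `z + 1` is pebbled then. This precedes the final
            -- clearing of `z + 1`, against the maximality of `z`.
            by_contra hno
            push Not at hno
            refine hmax (z + 1) (by omega) (by omega) ⟨by omega, fun u hu1 hu2 => ?_⟩
            have h1 := visits_pos_of_reached (σ := σ) (a := a) (b := b) (v := z + 1) hzb'.le
              (fun k' a1 a2 => h.place k' (by omega) (by omega)) hk2 hno hl.1 u hu1 hu2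
            exact h1.trans_le (visits_mono hk1 hl.2)
      -- The node `z + 1` belongs to neither part; the `+ 1` in the claimed bound pays for it.
      have hsub : (Finset.Ioc a b).filter (fun v => visits σ i j v ≤ t + 1) ⊆
          insert (z + 1) ((Finset.Ioc a z).filter (fun v => visits σ i j v ≤ t + 1) ∪
            (Finset.Ioc (z + 1) b).filter fun v => visits σ i j v ≤ t + 1) := by
        intro v hv
        simp only [Finset.mem_insert, Finset.mem_union, Finset.mem_filter, Finset.mem_Ioc] at hv ⊢
        omega
      have h1 := Finset.card_le_card hsub
      have h2 := Finset.card_insert_le (z + 1)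
        ((Finset.Ioc a z).filter (fun v => visits σ i j v ≤ t + 1) ∪
            (Finset.Ioc (z + 1) b).filter fun v => visits σ i j v ≤ t + 1)
      have h3 := Finset.card_union_le
        ((Finset.Ioc a z).filter (fun v => visits σ i j v ≤ t + 1))
        ((Finset.Ioc (z + 1) b).filter fun v => visits σ i j v ≤ t + 1)
      rw [pascal]
      omega

end Clears

/-! ### From visits to the number of steps -/

/-- The configurations that occur in a run. -/
theorem Runs.exists_trajectory {a b p : ℕ} {A : List Move} : ∀ {c d : Config}, Runs a b p c A d →
    ∃ σ : ℕ → Config, σ 0 = c ∧ σ A.length = d ∧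
      (∀ k, k < A.length → ∃ mv, Legal a b (σ k) mv ∧ σ (k + 1) = exec (σ k) mv) ∧
      ∀ k, k ≤ A.length → pebbleCount a b (σ k) ≤ p := by
  induction A with
  | nil =>
    rintro c d ⟨h1, rfl⟩
    exact ⟨fun _ => c, rfl, rfl, by simp, fun _ _ => h1⟩
  | cons mv A ih =>
    rintro c d ⟨h1, h2, h3⟩
    obtain ⟨σ, e0, e1, e2, e3⟩ := ih h3
    refine ⟨fun k => Nat.casesOn k c σ, rfl, e1, ?_, ?_⟩
    · rintro (_ | k) hk
      · exact ⟨mv, h2, e0⟩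
      · exact e2 k (by simpa using hk)
    · rintro (_ | k) hk
      · exact h1
      · exact e3 k (by simpa using hk)

theorem exec_of_ne {c : Config} {mv : Move} {v : ℕ} (h : v ≠ mv.node) : exec c mv v = c v := by
  cases mv <;> exact Function.update_of_ne h _ _

theorem eq_pebble_of_exec_eq_pebble {c : Config} {mv : Move} {v : ℕ} (h1 : c v ≠ .pebble)
    (h2 : exec c mv v = .pebble) : mv = .pebble v := by
  by_cases hv : v = mv.node
  · subst hv
    cases mv <;> simp_all [exec, Move.node]
  · exact absurd ((exec_of_ne hv).symm.trans h2) h1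

theorem eq_remove_of_exec_eq_empty {c : Config} {mv : Move} {v : ℕ} (h1 : c v ≠ .empty)
    (h2 : exec c mv v = .empty) : mv = .remove v := by
  by_cases hv : v = mv.node
  · subst hv
    cases mv <;> simp_all [exec, Move.node]
  · exact absurd ((exec_of_ne hv).symm.trans h2) h1

/-- Each step puts a pebble on at most one node; count by steps instead of by nodes. -/
theorem sum_visits_le {σ : ℕ → Config} {N : ℕ} (V : Finset ℕ)
    (h : ∀ k, k < N → ∃ mv, σ (k + 1) = exec (σ k) mv) : ∑ v ∈ V, visits σ 0 N v ≤ N := by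
  unfold visits
  simp_rw [Finset.card_filter]
  rw [Finset.sum_comm]
  calc _ ≤ ∑ k ∈ Finset.Ico 0 N, 1 := Finset.sum_le_sum fun k hk => ?_
    _ = N := by simp
  rw [← Finset.card_filter]
  refine Finset.card_le_one.2 fun u hu v hv => ?_
  obtain ⟨mv, hm⟩ := h k (by simpa using hk)
  simp only [Finset.mem_filter, hm] at hu hv
  have h1 := eq_pebble_of_exec_eq_pebble hu.2.1 hu.2.2
  have h2 := eq_pebble_of_exec_eq_pebble hv.2.1 hv.2.2
  simpa using h1.symm.trans h2

theorem Pebbles.le_length {n p : ℕ} {A : List Move} (h : Pebbles 0 n p A) : n ≤ A.length := by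
  rcases Nat.eq_zero_or_pos n with rfl | hn
  · exact Nat.zero_le _
  obtain ⟨σ, h0, h1, h2, -⟩ := h.exists_trajectory
  have hplace : PlacesLegally σ 0 n 0 A.length := by
    intro k _ hk v _ _ h3 h4
    obtain ⟨mv, hl, hm⟩ := h2 k hk
    obtain rfl := eq_pebble_of_exec_eq_pebble h3 (hm ▸ h4)
    exact hl.2.1
  have hv := visits_pos_of_reached (v := n) le_rfl hplace (Nat.zero_le _)
    (by intro u hu _; simp [h0, pebblesOn]; omega) (by simp [h1, pebblesOn])
  calc n = ∑ v ∈ Finset.Ioc 0 n, 1 := by simp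
    _ ≤ ∑ v ∈ Finset.Ioc 0 n, visits σ 0 A.length v :=
      Finset.sum_le_sum fun v hv' => hv v (Finset.mem_Ioc.1 hv').1 (Finset.mem_Ioc.1 hv').2
    _ ≤ A.length := sum_visits_le _ fun k hk => (h2 k hk).imp fun _ h => h.2

/-- A pebbling of `(0, n + 1]` with `s + 2` pebbles visits most nodes more than `t` times. -/
theorem Pebbles.mul_le_length {n s : ℕ} {A : List Move} (h : Pebbles 0 (n + 1) (s + 2) A) (t : ℕ) :
    (t + 1) * (n + 1) ≤ A.length + (t + 1) * (2 * (t + (s + 1)).choose s) := by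
  obtain ⟨σ, h0, h1, h2, h3⟩ := h.exists_trajectory
  -- the last time at which `n + 1` is not pebbled
  obtain ⟨q, hq, hqn, hafter⟩ : ∃ q, q < A.length ∧ σ q (n + 1) ≠ .pebble ∧
      ∀ k, q < k → k ≤ A.length → σ k (n + 1) = .pebble := by
    have e1 : σ 0 (n + 1) ≠ .pebble := by simp [h0, pebblesOn]
    have e2 := Nat.findGreatest_spec (P := fun k => σ k (n + 1) ≠ .pebble)
      (Nat.zero_le A.length) e1
    refine ⟨Nat.findGreatest (fun k => σ k (n + 1) ≠ .pebble) A.length,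
      lt_of_le_of_ne (Nat.findGreatest_le _) fun e => ?_, e2, fun k k1 k2 => ?_⟩
    · rw [e] at e2
      simp [h1, pebblesOn] at e2
    · simpa using Nat.findGreatest_is_greatest k1 k2
  -- The pebble on `n + 1` stays after time `q` and takes one of the `s + 2` pebbles.
  have hclears : Clears σ 0 n (q + 1) A.length (s + 1) := by
    refine ⟨?_, ?_, ?_, ?_, ?_⟩
    · intro k _ hk v _ _ h3 h4
      obtain ⟨mv, hl, hm⟩ := h2 k hk
      obtain rfl := eq_pebble_of_exec_eq_pebble h3 (hm ▸ h4)
      exact hl.2.1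
    · intro k _ hk v _ _ h3 h4
      obtain ⟨mv, hl, hm⟩ := h2 k hk
      obtain rfl := eq_remove_of_exec_eq_empty h3 (hm ▸ h4)
      exact ⟨hl.2.2, fun _ => hl.2.1⟩
    · intro k k1 k2
      have c1 := h3 k k2
      have c2 := Clears.pebbleCount_add 0 n (n + 1) (Nat.zero_le _) (Nat.le_succ _) (σ k)
      have c3 : 0 < pebbleCount n (n + 1) (σ k) :=
        Finset.card_pos.2 ⟨n + 1, by simp [hafter k (by omega) k2]⟩
      omega
    · intro v v1 v2
      simp [h1, pebblesOn]
      omega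
    -- The placement on `n + 1` needs a pebble on `n`, so `n` is not yet cleared.
    · intro hn
      refine ⟨q + 1, le_rfl, hq, ?_⟩
      obtain ⟨mv, hl, hm⟩ := h2 q hq
      obtain rfl := eq_pebble_of_exec_eq_pebble hqn (hm ▸ hafter (q + 1) (by omega) hq)
      rw [hm, exec_of_ne (by simp [Move.node])]
      have := hl.2.1
      simp only [Nat.add_sub_cancel] at this
      simp [this]
  have hcard := Clears.card_visits_le t s hclears
  have hcompl := Finset.card_filter_add_card_filter_not (s := Finset.Ioc 0 n)
    fun v => visits σ (q + 1) A.length v ≤ t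
  rw [Nat.card_Ioc] at hcompl
  have hsum : (t + 1) * ((Finset.Ioc 0 n).filter
      fun v => ¬ visits σ (q + 1) A.length v ≤ t).card ≤ A.length := by
    calc _ = ∑ v ∈ (Finset.Ioc 0 n).filter fun v => ¬ visits σ (q + 1) A.length v ≤ t,
          (t + 1) := by rw [Finset.sum_const, smul_eq_mul, mul_comm]
      _ ≤ ∑ v ∈ (Finset.Ioc 0 n).filter fun v => ¬ visits σ (q + 1) A.length v ≤ t,
          visits σ 0 A.length v := Finset.sum_le_sum fun v hv => by
            have e1 := (Finset.mem_filter.1 hv).2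
            have e2 := visits_mono (σ := σ) (v := v) (Nat.zero_le (q + 1)) (le_refl A.length)
            omega
      _ ≤ A.length := sum_visits_le _ fun k hk => (h2 k hk).imp fun _ h => h.2
  calc (t + 1) * (n + 1) ≤ (t + 1) * (((Finset.Ioc 0 n).filter
      fun v => ¬ visits σ (q + 1) A.length v ≤ t).card + 2 * (t + (s + 1)).choose s) :=
        Nat.mul_le_mul_left _ (by omega)
    _ ≤ _ := by rw [mul_add]; omega

/-! ### Correctness of the unpebbling algorithms -/

theorem Runs.append {a b p : ℕ} {A B : List Move} {d e : Config} :
    ∀ {c : Config}, Runs a b p c A d → Runs a b p d B e → Runs a b p c (A ++ B) e := by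
  induction A with
  | nil => rintro c ⟨-, rfl⟩ h; exact h
  | cons mv A ih => rintro c ⟨h1, h2, h3⟩ h; exact ⟨h1, h2, ih h3 h⟩

theorem Legal.mono {a b a' b' : ℕ} {c : Config} {mv : Move} (ha : a ≤ a') (hb : b' ≤ b)
    (h : Legal a' b' c mv) : Legal a b c mv := by
  cases mv <;> exact ⟨⟨by have := h.1; omega, by have := h.1; omega⟩, h.2⟩

theorem Legal.node_mem {a b : ℕ} {c : Config} {mv : Move} (h : Legal a b c mv) :
    a < mv.node ∧ mv.node ≤ b := by
  cases mv <;> exact h.1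

theorem pebbleCount_congr {a b : ℕ} {c d : Config} (h : ∀ v, a < v → v ≤ b → c v = d v) :
    pebbleCount a b c = pebbleCount a b d := by
  unfold pebbleCount
  congr 1
  refine Finset.filter_congr fun v hv => ?_
  rw [Finset.mem_Ioc] at hv
  rw [h v hv.1 hv.2]

theorem pebbleCount_eq_zero {a b : ℕ} {c : Config} (h : ∀ v, a < v → v ≤ b → c v ≠ .pebble) :
    pebbleCount a b c = 0 := by
  refine Finset.card_eq_zero.2 (Finset.filter_eq_empty_iff.2 fun v hv => ?_)
  rw [Finset.mem_Ioc] at hv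
  exact h v hv.1 hv.2

theorem pebbleCount_le_card {a b : ℕ} {c : Config} (S : Finset ℕ)
    (h : ∀ v, a < v → v ≤ b → c v = .pebble → v ∈ S) : pebbleCount a b c ≤ S.card := by
  refine Finset.card_le_card fun v hv => ?_
  simp only [Finset.mem_filter, Finset.mem_Ioc] at hv
  exact h v hv.1.1 hv.1.2 hv.2

/-- A run on a subinterval is a run on the whole interval; the pebbles outside stay. -/
theorem Runs.widen {a b a' b' p q : ℕ} {A : List Move} {d : Config} (ha : a ≤ a') (hab : a' ≤ b')
    (hb : b' ≤ b) : ∀ {c : Config}, Runs a' b' p c A d →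
      pebbleCount a a' c + pebbleCount b' b c ≤ q → Runs a b (p + q) c A d := by
  have key : ∀ c, pebbleCount a b c =
      pebbleCount a' b' c + (pebbleCount a a' c + pebbleCount b' b c) := by
    intro c
    rw [← Clears.pebbleCount_add a a' b ha (hab.trans hb),
      ← Clears.pebbleCount_add a' b' b hab hb]
    ring
  induction A with
  | nil =>
    rintro c ⟨h1, rfl⟩ hq
    exact ⟨by rw [key]; omega, rfl⟩
  | cons mv A ih =>
    rintro c ⟨h1, h2, h3⟩ hq
    refine ⟨by rw [key]; omega, h2.mono ha hb, ih h3 (le_trans (le_of_eq ?_) hq)⟩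
    have hm := h2.node_mem
    congr 1 <;> refine pebbleCount_congr fun v _ _ => exec_of_ne (by omega)

theorem Runs.mono {a b p q : ℕ} {A : List Move} {c d : Config} (h : Runs a b p c A d)
    (hpq : p ≤ q) : Runs a b q c A d := by
  induction A generalizing c with
  | nil => exact ⟨h.1.trans hpq, h.2⟩
  | cons mv A ih => exact ⟨h.1.trans hpq, h.2.1, ih h.2.2⟩

/-- The configuration with a pebble at `a + k` and ghosts on `(a, a + k)`. -/
def swept (a k : ℕ) (c : Config) : Config := fun v =>
  if v = a + k then .pebble else if a < v ∧ v < a + k then .ghost else c v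

theorem sweep_succ {a k : ℕ} (hk : 0 < k) :
    sweep a (k + 1) = sweep a k ++ [.pebble (a + k + 1), .ghost (a + k)] := by
  obtain ⟨k, rfl⟩ := Nat.exists_eq_succ_of_ne_zero hk.ne'
  simp [sweep, List.range_succ, List.flatMap_append]
  omega

theorem runs_sweep {a k : ℕ} {c : Config} (hk : 0 < k) (ha : c a = .pebble)
    (hc : ∀ v, a < v → v ≤ a + k → c v ≠ .pebble) :
    Runs a (a + k) 2 c (sweep a k) (swept a k c) := by
  induction k, hk using Nat.le_induction with
  | base =>
    refine ⟨by rw [pebbleCount_eq_zero hc]; omega,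
      ⟨by omega, by simpa using ha, hc _ (by omega) le_rfl⟩, ?_, ?_⟩
    · refine (pebbleCount_le_card {a + 1} fun v _ _ _ => ?_).trans (by simp)
      simp; omega
    · funext v
      simp only [exec, swept, Function.update_apply, Nat.succ_eq_add_one, zero_add]
      split_ifs <;> first | rfl | omega
  | succ k hk ih =>
    have hk' : 0 < k := hk
    rw [sweep_succ hk]
    have h1 := (ih fun v h1 h2 => hc v h1 (by omega)).widen (b := a + (k + 1)) (q := 0) le_rfl
      (by omega) (by omega) (by
        rw [pebbleCount_eq_zero (by omega),
          pebbleCount_eq_zero fun v h1 h2 => hc v (by omega) (by omega)])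
    have hs : ∀ v, a < v → v ≤ a + (k + 1) → swept a k c v = .pebble → v = a + k := by
      intro v h1 h2 h3
      by_contra h
      simp only [swept, h, if_false] at h3
      split_ifs at h3
      exact hc v h1 h2 h3
    refine h1.append ⟨?_, ⟨by omega, by simp [swept], ?_⟩, ?_, ⟨by omega, ?_⟩, ?_, ?_⟩
    · exact (pebbleCount_le_card {a + k} fun v h1 h2 h3 => by simp [hs v h1 h2 h3]).trans (by simp)
    · exact fun h => absurd (hs _ (by omega) le_rfl h) (by omega)
    · refine (pebbleCount_le_card {a + k, a + k + 1} fun v h1 h2 h3 => ?_).trans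
        (Finset.card_le_two)
      by_cases hv : v = a + k + 1
      · simp [hv]
      · rw [exec_of_ne (by simpa [Move.node] using hv)] at h3
        simp [hs v h1 h2 h3]
    · simp [exec, swept]
    · refine (pebbleCount_le_card {a + k, a + k + 1} fun v h1 h2 h3 => ?_).trans
        (Finset.card_le_two)
      by_cases hv : v = a + k + 1
      · simp [hv]
      by_cases hv' : v = a + k
      · simp [hv']
      rw [exec_of_ne (by simpa [Move.node] using hv'),
        exec_of_ne (by simpa [Move.node] using hv)] at h3
      simp [hs v h1 h2 h3]
    · funext v
      simp only [exec, swept, Function.update_apply]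
      split_ifs <;> first | rfl | omega

/-- The configuration in which `(a, b]` has been cleared. -/
def cleared (a b : ℕ) (c : Config) : Config := fun v => if a < v ∧ v ≤ b then .empty else c v

/-- Pebbles at both ends of `(a, b]` and none in between; ghosts are allowed. -/
def Ready (a b : ℕ) (c : Config) : Prop :=
  c a = .pebble ∧ c b = .pebble ∧ ∀ v, a < v → v < b → c v ≠ .pebble

theorem runs_quadUnpebble (a : ℕ) : ∀ (n : ℕ), 1 ≤ n → ∀ c, Ready a (a + n) c →
    Runs a (a + n) 2 c (quadUnpebble a n) (cleared a (a + n) c)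
  | 0, h, _, _ => absurd h (by omega)
  | 1, _, c, hc => by
    refine ⟨?_, ⟨by omega, by simpa using hc.1, hc.2.1⟩, ?_, ?_⟩
    · exact (pebbleCount_le_card {a + 1} fun v _ _ _ => by simp; omega).trans (by simp)
    · exact (pebbleCount_le_card {a + 1} fun v _ _ _ => by simp; omega).trans (by simp)
    · funext v
      simp only [exec, cleared, Function.update_apply]
      split_ifs <;> first | rfl | omega
  | 2, _, c, hc => by
    have hcard : ∀ c' : Config, pebbleCount a (a + 2) c' ≤ 2 := fun c' =>
      (pebbleCount_le_card {a + 1, a + 2} fun v _ _ _ => by simp; omega).trans Finset.card_le_two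
    refine ⟨hcard _, ⟨by omega, by simpa using hc.1, hc.2.2 _ (by omega) (by omega)⟩, hcard _,
      ⟨by omega, by simp [exec], by simp [exec, hc.2.1]⟩, hcard _,
      ⟨by omega, by simp [exec, hc.1], by simp [exec]⟩, hcard _, ?_⟩
    funext v
    simp only [exec, cleared, Function.update_apply]
    split_ifs <;> first | rfl | omega
  | n + 3, _, c, hc => by
    obtain ⟨hc1, hc2, hc3⟩ := hc
    set c1 : Config := exec c (.ghost (a + n + 3)) with hc1'
    have hc1a : c1 a = .pebble := by rw [hc1', exec_of_ne (by simp [Move.node]; omega), hc1]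
    have hc1v : ∀ v, a < v → v ≤ a + (n + 3) → c1 v ≠ .pebble := by
      intro v h1 h2
      by_cases hv : v = a + n + 3
      · subst hv; simp [hc1', exec]
      · rw [hc1', exec_of_ne (by simpa [Move.node] using hv)]
        exact hc3 v h1 (by omega)
    have hsw := (runs_sweep (a := a) (k := n + 2) (by omega) hc1a
      fun v h1 h2 => hc1v v h1 (by omega)).widen (b := a + (n + 3)) (q := 0) le_rfl
      (by omega) (by omega) (by
        rw [pebbleCount_eq_zero (by omega),
          pebbleCount_eq_zero fun v h1 h2 => hc1v v (by omega) (by omega)])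
    set c2 := swept a (n + 2) c1 with hc2'
    have hs : ∀ v, a < v → v ≤ a + (n + 3) → c2 v = .pebble → v = a + (n + 2) := by
      intro v h1 h2 h3
      by_contra h
      simp only [hc2', swept, h, if_false] at h3
      split_ifs at h3
      exact hc1v v h1 h2 h3
    have e2 : c2 (a + (n + 2)) = .pebble := by simp [hc2', swept]
    have e2a : c2 a = .pebble := by simp [hc2', swept, hc1a]
    have hcard : pebbleCount a (a + (n + 3)) c2 ≤ 1 :=
      (pebbleCount_le_card {a + (n + 2)} fun v h1 h2 h3 => by simp [hs v h1 h2 h3]).trans (by simp)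
    have hcard2 : ∀ mv : Move, mv.node = a + n + 3 →
        ∀ mv' : Move, mv'.node = a + n + 3 → pebbleCount a (a + (n + 3))
          (exec (exec c2 mv') mv) ≤ 2 ∧ pebbleCount a (a + (n + 3)) (exec c2 mv) ≤ 2 := by
      intro mv hmv mv' hmv'
      constructor <;>
      · refine (pebbleCount_le_card {a + (n + 2), a + n + 3} fun v h1 h2 h3 => ?_).trans
          Finset.card_le_two
        by_cases hv : v = a + n + 3
        · simp [hv]
        · simp only [exec_of_ne (hmv.symm ▸ hv), exec_of_ne (hmv'.symm ▸ hv)] at h3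
          simp [hs v h1 h2 h3]
    set c3 := exec (exec c2 (.pebble (a + n + 3))) (.remove (a + n + 3)) with hc3'
    have hmid : Runs a (a + (n + 3)) 2 c2
        [.pebble (a + n + 3), .remove (a + n + 3)] c3 := by
      refine ⟨hcard.trans (by omega), ⟨by omega, e2, fun h => ?_⟩,
        (hcard2 _ rfl (.remove (a + n + 3)) rfl).2, ⟨by omega, ?_, by simp [exec]⟩,
        (hcard2 _ rfl _ rfl).1, rfl⟩
      · exact absurd (hs _ (by omega) (by omega) h) (by omega)
      · rw [exec_of_ne (by simp [Move.node])]
        exact e2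
    have e3 : ∀ v, v ≠ a + n + 3 → c3 v = c2 v := fun v hv => by
      rw [hc3', exec_of_ne (by simpa [Move.node] using hv),
        exec_of_ne (by simpa [Move.node] using hv)]
    have e3' : c3 (a + n + 3) = .empty := by simp [hc3', exec]
    have hrec := (runs_quadUnpebble a (n + 2) (by omega) c3 ⟨by rw [e3 _ (by omega), e2a],
      by rw [e3 _ (by omega), e2], fun v h1 h2 h3 => by
        rw [e3 _ (by omega)] at h3
        exact absurd (hs v h1 (by omega) h3) (by omega)⟩).widen (b := a + (n + 3)) (q := 0) le_rfl
      (by omega) (by omega) (by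
        rw [pebbleCount_eq_zero (by omega), pebbleCount_eq_zero fun v h1 h2 => by
          rw [show v = a + n + 3 by omega, e3']; simp])
    have hend : cleared a (a + (n + 2)) c3 = cleared a (a + (n + 3)) c := by
      funext v
      by_cases hv : v = a + n + 3
      · subst hv
        simp [cleared, e3']
        omega
      · simp only [cleared, e3 v hv, hc2', swept, hc1', exec, Function.update_apply]
        split_ifs <;> first | rfl | omega
    rw [hend] at hrec
    refine ((Runs.append (A := .ghost (a + n + 3) :: sweep a (n + 2)) ⟨?_, ⟨by omega, ?_⟩, hsw⟩
      hmid).append hrec)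
    · exact (pebbleCount_le_card {a + (n + 3)} fun v h1 h2 h3 => by
        by_contra hv
        exact hc3 v h1 (by simp at hv; omega) h3).trans (by simp)
    · exact hc2

theorem one_le_checkpoint (n s : ℕ) : 1 ≤ checkpoint n s := by
  unfold checkpoint
  by_cases hm : invBinom n s ≤ 1
  · simp [hm]
  · simp only [hm, if_false]
    exact le_max_of_le_left (Nat.choose_pos (by omega))

/-- Starting from `Ready` admits the ghosts that the sweep leaves for the left call. Pebble budget
for `2 ≤ s`: the sweep uses two besides the one at `a + n`; the right call uses `s` besides the one
at `a + k`; the left call finds `(a + k, a + n]` empty and uses all `s + 1`. -/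
theorem runs_optUnpebble (s n : ℕ) : ∀ a, 1 ≤ n → 1 ≤ s → ∀ c, Ready a (a + n) c →
    Runs a (a + n) (s + 1) c (optUnpebble a n s) (cleared a (a + n) c) := by
  induction s using Nat.strong_induction_on generalizing n with
  | _ s ihs =>
  induction n using Nat.strong_induction_on with
  | _ n ihn =>
  intro a hn hs c hc
  rw [optUnpebble]
  split_ifs with hns
  · exact (runs_quadUnpebble a n hn c hc).mono (by omega)
  have hk := one_le_checkpoint n s
  have hkn := checkpoint_lt (s := s) (show 1 < n by omega)
  set k := checkpoint n s
  obtain ⟨hc1, hc2, hc3⟩ := hc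
  have hsw := (runs_sweep (a := a) (k := k) hk hc1 fun v h1 h2 => hc3 v h1 (by omega)).widen
    (b := a + n) (q := 1) le_rfl (by omega) (by omega) (by
      rw [pebbleCount_eq_zero (by omega), zero_add]
      exact (pebbleCount_le_card {a + n} fun v h1 h2 h3 => by
        by_contra hv
        exact hc3 v (by omega) (by simp at hv; omega) h3).trans (by simp))
  set c1 := swept a k c with hc1'
  have en : a + k + (n - k) = a + n := by omega
  have hr := ihs (s - 1) (by omega) (n - k) (a + k) (by omega) (by omega) c1
    ⟨by simp [hc1', swept], by simp [hc1', swept, en, hc2, hkn.ne', hkn.le], fun v h1 h2 => by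
      simp only [hc1', swept, show v ≠ a + k by omega, show ¬ (a < v ∧ v < a + k) by omega,
        if_false]
      exact hc3 v (by omega) (by omega)⟩
  rw [en, Nat.sub_add_cancel hs] at hr
  have hr' := hr.widen (a := a) (b := a + n) (q := 1) (by omega) (by omega) le_rfl (by
      rw [pebbleCount_eq_zero (a := a + n) (by omega), add_zero]
      refine (pebbleCount_le_card {a + k} fun v h1 h2 h3 => ?_).trans (by simp)
      by_contra hv
      simp only [Finset.mem_singleton] at hv
      simp only [hc1', swept, hv, show a < v ∧ v < a + k by omega, if_false] at h3
      simp at h3)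
  set c2 := cleared (a + k) (a + n) c1 with hc2'
  have hl := (ihn k hkn a hk hs c2 ⟨by simp [hc2', cleared, hc1', swept, hc1],
    by simp [hc2', cleared, hc1', swept], fun v h1 h2 => by
      simp [hc2', cleared, hc1', swept, show v ≠ a + k by omega, h1, h2,
        show ¬ (a + k < v) by omega]⟩).widen (a := a) (b := a + n) (q := 0) le_rfl (by omega)
      (by omega) (by
        rw [pebbleCount_eq_zero (by omega), pebbleCount_eq_zero fun v h1 h2 => by
          simp [hc2', cleared, h1, h2]])
  have hend : cleared a (a + k) c2 = cleared a (a + n) c := by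
    funext v
    simp only [cleared, hc2', swept, hc1']
    split_ifs <;> first | rfl | omega
  rw [hend] at hl
  exact ((hsw.mono (by omega)).append hr').append hl

theorem optUnpebble_unpebbles {a n s : ℕ} (hn : 1 ≤ n) (hs : 1 ≤ s) :
    Unpebbles a (a + n) (s + 1) (optUnpebble a n s) := by
  have h := runs_optUnpebble s n a hn hs (pebblesOn {a, a + n})
    ⟨by simp [pebblesOn], by simp [pebblesOn], fun v h1 h2 => by
      simp [pebblesOn, h1.ne', h2.ne]⟩
  have e : cleared a (a + n) (pebblesOn {a, a + n}) = pebblesOn {a} := by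
    funext v
    simp only [cleared, pebblesOn, Finset.mem_insert, Finset.mem_singleton]
    split_ifs <;> first | rfl | omega
  rwa [e] at h

/-! ### From unpebbling to pebbling -/

/-- Agreement of configurations off a node. -/
def AgreeOff (b : ℕ) (c d : Config) : Prop := ∀ v, v ≠ b → c v = d v

theorem AgreeOff.pebbleCount_le {a b : ℕ} {c c' : Config} (h : AgreeOff b c' c) :
    pebbleCount a b c' ≤ pebbleCount a b c + 1 := by
  unfold pebbleCount
  refine le_trans (Finset.card_le_card (t := insert b _) fun v hv => ?_) (Finset.card_insert_le b _)
  simp only [Finset.mem_insert, Finset.mem_filter] at hv ⊢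
  by_cases hvb : v = b
  · exact Or.inl hvb
  · exact Or.inr ⟨hv.1, (h v hvb).symm.trans hv.2⟩

theorem AgreeOff.exec_of_node {b : ℕ} {c c' : Config} {mv : Move} (h : AgreeOff b c' c)
    (hm : mv.node = b) : AgreeOff b c' (exec c mv) := fun v hv => by
  rw [exec_of_ne (hm.symm ▸ hv), h v hv]

theorem AgreeOff.exec_exec {b : ℕ} {c c' : Config} (h : AgreeOff b c' c) (mv : Move) :
    AgreeOff b (exec c' mv) (exec c mv) := fun v hv => by
  by_cases hm : v = mv.node
  · subst hm
    cases mv <;> simp [exec, Move.node]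
  · rw [exec_of_ne hm, exec_of_ne hm, h v hv]

theorem AgreeOff.legal {a b : ℕ} {c c' : Config} {mv : Move} (h : AgreeOff b c' c)
    (hm : mv.node ≠ b) (hl : Legal a b c mv) : Legal a b c' mv := by
  have hb := hl.node_mem
  cases mv with
  | ghost v => exact ⟨hl.1, (h v hm).trans hl.2⟩
  | pebble v =>
    exact ⟨hl.1, (h (v - 1) (by simp only [Move.node] at hb; omega)).trans hl.2.1,
      by rw [h v hm]; exact hl.2.2⟩
  | remove v =>
    exact ⟨hl.1, (h (v - 1) (by simp only [Move.node] at hb; omega)).trans hl.2.1,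
      (h v hm).trans hl.2.2⟩

/-- No legal move at a node other than the right end `b` depends on the content of `b`, so the moves
at `b` can be dropped; a pebble on `b` costs at most one more. -/
theorem runs_toPebbling_of_notMem {a b p : ℕ} {A : List Move} {d : Config} (hA : .remove b ∉ A) :
    ∀ {c c' : Config}, Runs a b p c A d → AgreeOff b c' c →
      ∃ d', Runs a b (p + 1) c' (toPebbling b A) d' ∧ AgreeOff b d' d ∧ d' b = c' b := by
  induction A with
  | nil =>
    rintro c c' ⟨h1, rfl⟩ h
    exact ⟨c', ⟨h.pebbleCount_le.trans (by omega), rfl⟩, h, rfl⟩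
  | cons mv A ih =>
    rintro c c' ⟨h1, h2, h3⟩ h
    simp only [List.mem_cons, not_or] at hA
    simp only [toPebbling]
    split_ifs with hm hr
    · exact absurd hr.1.symm hA.1
    · exact ih hA.2 h3 (h.exec_of_node hm)
    · obtain ⟨d', e1, e2, e3⟩ := ih hA.2 h3 (h.exec_exec mv)
      exact ⟨d', ⟨h.pebbleCount_le.trans (by omega), h.legal hm h2, e1⟩, e2,
        by rw [e3, exec_of_ne (Ne.symm hm)]⟩

theorem runs_toPebbling_of_mem {a b p : ℕ} {A : List Move} {d : Config} (hA : .remove b ∈ A) :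
    ∀ {c c' : Config}, Runs a b p c A d → AgreeOff b c' c → c' b ≠ .pebble →
      ∃ d', Runs a b (p + 1) c' (toPebbling b A) d' ∧ AgreeOff b d' d ∧ d' b = .pebble := by
  induction A with
  | nil => simp at hA
  | cons mv A ih =>
    rintro c c' ⟨h1, h2, h3⟩ h hb
    simp only [toPebbling]
    split_ifs with hm hr
    · obtain ⟨rfl, hr⟩ := hr
      have hag : AgreeOff b (exec c' (.pebble b)) (exec c (.remove b)) := fun v hv => by
        rw [exec_of_ne hv, exec_of_ne hv, h v hv]
      obtain ⟨d', e1, e2, e3⟩ := runs_toPebbling_of_notMem hr h3 hag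
      refine ⟨d', ⟨h.pebbleCount_le.trans (by omega), ⟨h2.1, ?_, hb⟩, e1⟩, e2, ?_⟩
      · have := h2.1
        exact (h (b - 1) (by omega)).trans h2.2.1
      · rw [e3]; simp [exec]
    · have hmem : .remove b ∈ A := by
        by_contra hn
        rcases List.mem_cons.1 hA with e | e
        · exact hr ⟨e.symm, hn⟩
        · exact hn e
      exact ih hmem h3 (h.exec_of_node hm) hb
    · have hmem : .remove b ∈ A := by
        rcases List.mem_cons.1 hA with e | e
        · exact absurd (by rw [← e]; rfl) hm
        · exact e
      obtain ⟨d', e1, e2, e3⟩ := ih hmem h3 (h.exec_exec mv)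
        (by rwa [exec_of_ne (Ne.symm hm)])
      exact ⟨d', ⟨h.pebbleCount_le.trans (by omega), h.legal hm h2, e1⟩, e2, e3⟩

theorem Runs.remove_mem {a b p v : ℕ} {A : List Move} {d : Config} :
    ∀ {c : Config}, Runs a b p c A d → c v ≠ .empty → d v = .empty → .remove v ∈ A := by
  induction A with
  | nil => rintro c ⟨-, rfl⟩ h1 h2; exact absurd h2 h1
  | cons mv A ih =>
    rintro c ⟨-, -, h3⟩ h1 h2
    by_cases h : exec c mv v = .empty
    · simp [eq_remove_of_exec_eq_empty h1 h]
    · exact List.mem_cons_of_mem _ (ih h3 h h2)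

/-- Every unpebbling becomes a pebbling with one more pebble. -/
theorem Unpebbles.toPebbling {a b p : ℕ} {A : List Move} (hab : a < b) (h : Unpebbles a b p A) :
    Pebbles a b (p + 1) (toPebbling b A) := by
  have hmem : .remove b ∈ A := h.remove_mem (v := b) (by simp [pebblesOn])
    (by simp [pebblesOn, hab.ne'])
  have hag : AgreeOff b (pebblesOn {a}) (pebblesOn {a, b}) := fun v hv => by
    simp [pebblesOn, hv]
  obtain ⟨d', h1, h2, h3⟩ := runs_toPebbling_of_mem hmem h hag (by simp [pebblesOn, hab.ne'])
  have e : d' = pebblesOn {a, b} := by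
    funext v
    by_cases hv : v = b
    · subst hv; simp [h3, pebblesOn]
    · rw [h2 v hv]; simp [pebblesOn, hv]
  rwa [e] at h1

theorem length_toPebbling_le (b : ℕ) (A : List Move) : (toPebbling b A).length ≤ A.length := by
  induction A with
  | nil => simp [toPebbling]
  | cons mv A ih =>
    simp only [toPebbling]
    split_ifs <;> simp only [List.length_cons] <;> omega

theorem optPebble_pebbles {a n s : ℕ} (hn : 1 ≤ n) (hs : 1 ≤ s) :
    Pebbles a (a + n) (s + 2) (optPebble a n s) :=
  (optUnpebble_unpebbles hn hs).toPebbling (by omega)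

/-! ### Inverse binomials and the length of the algorithms -/

theorem le_choose_self {n s : ℕ} (hs : 1 ≤ s) : n ≤ (s + n).choose n := by
  calc n ≤ n + 1 := Nat.le_succ n
    _ = (1 + n).choose n := by rw [add_comm 1 n, Nat.choose_succ_self_right]
    _ ≤ (s + n).choose n := Nat.choose_le_choose n (by omega)

theorem le_choose_invBinom {n s : ℕ} (hs : 1 ≤ s) :
    n ≤ (s + invBinom n s).choose (invBinom n s) :=
  Nat.sInf_mem (s := {z | n ≤ (s + z).choose z}) ⟨n, le_choose_self hs⟩

theorem invBinom_le {n s z : ℕ} (h : n ≤ (s + z).choose z) : invBinom n s ≤ z := Nat.sInf_le h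

theorem choose_lt_of_lt_invBinom {n s z : ℕ} (h : z < invBinom n s) : (s + z).choose z < n :=
  not_le.1 (Nat.notMem_of_lt_sInf (s := {z | n ≤ (s + z).choose z}) h)

theorem one_le_invBinom {n s : ℕ} (hn : 2 ≤ n) (hs : 1 ≤ s) : 1 ≤ invBinom n s := by
  by_contra h
  have h1 := le_choose_invBinom (n := n) hs
  rw [show invBinom n s = 0 by omega] at h1
  simp at h1
  omega

theorem length_sweep {a k : ℕ} (hk : 1 ≤ k) : (sweep a k).length + 1 = 2 * k := by
  induction k, hk using Nat.le_induction with
  | base => simp [sweep]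
  | succ k hk ih =>
    rw [sweep_succ hk, List.length_append]
    simp only [List.length_cons, List.length_nil]
    omega

theorem length_quadUnpebble (a : ℕ) : ∀ n, (quadUnpebble a n).length ≤ n * (n + 1)
  | 0 => by simp [quadUnpebble]
  | 1 => by simp [quadUnpebble]
  | 2 => by simp [quadUnpebble]
  | n + 3 => by
    have h1 := length_quadUnpebble a (n + 2)
    have h2 := length_sweep (a := a) (k := n + 2) (by omega)
    simp only [quadUnpebble, List.length_append, List.length_cons, List.length_nil]
    nlinarith

theorem checkpoint_le {n s m : ℕ} (hm : invBinom n s = m + 2) :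
    checkpoint n s ≤ (s + (m + 1)).choose (m + 1) := by
  have h4 := Nat.choose_succ_succ (s + m) m
  have h5 : (s + m).choose m ≤ (s + (m + 1)).choose (m + 1) := by
    rw [← add_assoc, h4]; omega
  simp only [checkpoint, hm, show ¬ m + 2 ≤ 1 by omega, if_false, Nat.add_sub_cancel,
    show s + (m + 2) - 2 = s + m by omega, show s + (m + 2) - 1 = s + (m + 1) by omega,
    show m + 2 - 1 = m + 1 by omega]
  omega

/-- Pascal's rule splits `n + z`, and the second entry of the maximum leaves at most the second
summand for the right part. -/
theorem sub_checkpoint_le {n s m : ℕ} (hs : 1 ≤ s) (hm : invBinom n s = m + 2) :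
    n - checkpoint n s ≤ (s - 1 + (m + 2)).choose (m + 2) := by
  have h1 := le_choose_invBinom (n := n) hs
  rw [hm] at h1
  have h2 : (s + (m + 2)).choose (m + 2) =
      (s + (m + 1)).choose (m + 1) + (s + (m + 1)).choose (m + 2) :=
    Nat.choose_succ_succ (s + (m + 1)) (m + 1)
  simp only [checkpoint, hm, show ¬ m + 2 ≤ 1 by omega, if_false, Nat.add_sub_cancel,
    show s + (m + 2) - 2 = s + m by omega, show s + (m + 2) - 1 = s + (m + 1) by omega,
    show m + 2 - 1 = m + 1 by omega]
  rw [show s - 1 + (m + 2) = s + (m + 1) by omega]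
  omega

theorem length_optUnpebble (s n : ℕ) (hs : 1 ≤ s) (hn : 1 ≤ n) :
    ∀ a, (optUnpebble a n s).length ≤ n * (2 * invBinom n s + 1) := by
  induction s using Nat.strong_induction_on generalizing n with
  | _ s ihs =>
  induction n using Nat.strong_induction_on with
  | _ n ihn =>
  intro a
  rw [optUnpebble]
  split_ifs with hns
  · rcases Nat.eq_or_lt_of_le hn with rfl | hn
    · simp [quadUnpebble]
    -- For `s = 1`, `n ≤ B⁻¹(n, 1) + 1`, so the quadratic length fits the bound.
    refine (length_quadUnpebble a n).trans (Nat.mul_le_mul_left n ?_)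
    obtain rfl : s = 1 := by omega
    have h1 := le_choose_invBinom (n := n) hs
    have h2 := one_le_invBinom hn hs
    rw [add_comm, Nat.choose_succ_self_right] at h1
    omega
  have hk := one_le_checkpoint n s
  have hkn := checkpoint_lt (s := s) (show 1 < n by omega)
  have hB := one_le_invBinom (n := n) (by omega) hs
  have hsw := length_sweep (a := a) hk
  have hl := ihn _ hkn hk a
  have hr := ihs (s - 1) (by omega) (n - checkpoint n s) (by omega) (by omega)
    (a + checkpoint n s)
  rw [List.length_append, List.length_append]
  have hr' : invBinom (n - checkpoint n s) (s - 1) ≤ invBinom n s := by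
    rcases Nat.eq_or_lt_of_le hB with hB | hB
    · have h1 := le_choose_invBinom (n := n) hs
      rw [← hB, Nat.choose_one_right] at h1
      rw [← hB]
      refine invBinom_le ?_
      rw [Nat.choose_one_right]
      omega
    · obtain ⟨m, hm⟩ := Nat.exists_eq_add_of_le' (show 2 ≤ invBinom n s from hB)
      rw [hm]
      exact invBinom_le (sub_checkpoint_le hs hm)
  have hl' : invBinom (checkpoint n s) s + 1 ≤ invBinom n s := by
    rcases Nat.eq_or_lt_of_le hB with hB | hB
    · have e : checkpoint n s = 1 := by simp [checkpoint, ← hB]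
      rw [e, ← hB]
      exact Nat.succ_le_succ (invBinom_le (by simp))
    · obtain ⟨m, hm⟩ := Nat.exists_eq_add_of_le' (show 2 ≤ invBinom n s from hB)
      rw [hm]
      exact Nat.succ_le_succ (invBinom_le (checkpoint_le hm))
  obtain ⟨j, hj⟩ := Nat.exists_eq_add_of_lt hkn
  generalize checkpoint n s = k at *
  subst hj
  rw [show k + j + 1 - k = j + 1 by omega] at hr hr' ⊢
  generalize invBinom (k + j + 1) s = B at *
  -- The drop of `B` by one saves `2 * k` steps on the left, more than the `2 * k - 1` steps of the
  -- sweep.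
  have h1 := hl.trans (Nat.mul_le_mul_left k (show _ ≤ 2 * (B - 1) + 1 by omega))
  have h2 := hr.trans (Nat.mul_le_mul_left (j + 1) (show _ ≤ 2 * B + 1 by omega))
  obtain ⟨B, rfl⟩ := Nat.exists_eq_add_of_le' hB
  simp only [Nat.add_sub_cancel] at h1
  nlinarith

/-! ### Comparison of the two bounds -/

theorem four_mul_choose_le {x s : ℕ} (hx : 1 ≤ x) (hs : 1 ≤ s) :
    4 * (x + s).choose s ≤ (8 * x + s).choose s := by
  induction s, hs using Nat.le_induction with
  | base => simp only [Nat.choose_one_right]; omega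
  | succ s hs ih =>
    have h1 := Nat.add_one_mul_choose_eq (x + s) s
    have h2 := Nat.add_one_mul_choose_eq (8 * x + s) s
    refine Nat.le_of_mul_le_mul_right (c := s + 1) ?_ (Nat.succ_pos s)
    rw [mul_assoc, ← add_assoc, ← add_assoc, ← h1, ← h2]
    calc 4 * ((x + s + 1) * (x + s).choose s) = (x + s + 1) * (4 * (x + s).choose s) := by ring
      _ ≤ (8 * x + s + 1) * (8 * x + s).choose s := Nat.mul_le_mul (by omega) ih

theorem Pebbles.mul_invBinom_le {n s : ℕ} {A : List Move} (hs : 1 ≤ s)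
    (h : Pebbles 0 n (s + 2) A) : n * invBinom n s ≤ 32 * A.length := by
  rcases le_or_gt (invBinom n s) 8 with hB | hB
  · have h1 := h.le_length
    nlinarith
  obtain ⟨n, rfl⟩ : ∃ k, n = k + 1 := by
    refine Nat.exists_eq_add_one_of_ne_zero ?_
    rintro rfl
    have := invBinom_le (n := 0) (s := s) (z := 0) (by simp)
    omega
  -- Since `8 * (t + 1) < B⁻¹`, `four_mul_choose_le` bounds the exceptional nodes by half of `n +
  -- 1`; since `B⁻¹ ≤ 16 * (t + 1)`, the total loss is the factor 32.
  obtain ⟨t, ht⟩ : ∃ t, (invBinom (n + 1) s - 1) / 8 = t + 1 :=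
    Nat.exists_eq_add_one_of_ne_zero (by omega)
  have h1 := h.mul_le_length t
  have h2 := choose_lt_of_lt_invBinom (n := n + 1) (s := s) (z := 8 * (t + 1)) (by omega)
  have h3 := four_mul_choose_le (x := t + 1) (s := s) (by omega) hs
  rw [add_comm, Nat.choose_symm_add] at h2
  rw [show t + (s + 1) = t + 1 + s by ring] at h1
  have h4 : invBinom (n + 1) s ≤ 16 * (t + 1) := by omega
  have h5 := Nat.mul_le_mul_left (t + 1) (h3.trans h2.le)
  have h6 := Nat.mul_le_mul_left (n + 1) h4
  nlinarith

theorem exists_minPebbleSteps {n s : ℕ} (hn : 1 ≤ n) (hs : 1 ≤ s) :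
    ∃ A : List Move, Pebbles 0 n (s + 2) A ∧ A.length = minPebbleSteps n s := by
  have h := optPebble_pebbles (a := 0) hn hs
  rw [zero_add] at h
  exact Nat.sInf_mem (s := {t | ∃ A : List Move, Pebbles 0 n (s + 2) A ∧ A.length = t})
    ⟨_, _, h, rfl⟩

theorem exists_minUnpebbleSteps {n s : ℕ} (hn : 1 ≤ n) (hs : 1 ≤ s) :
    ∃ A : List Move, Unpebbles 0 n (s + 1) A ∧ A.length = minUnpebbleSteps n s := by
  have h := optUnpebble_unpebbles (a := 0) hn hs
  rw [zero_add] at h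
  exact Nat.sInf_mem (s := {t | ∃ A : List Move, Unpebbles 0 n (s + 1) A ∧ A.length = t})
    ⟨_, _, h, rfl⟩

theorem minPebbleSteps_le {n s : ℕ} {A : List Move} (h : Pebbles 0 n (s + 2) A) :
    minPebbleSteps n s ≤ A.length := Nat.sInf_le ⟨A, h, rfl⟩

theorem minPebbleSteps_le_minUnpebbleSteps {n s : ℕ} (hn : 1 ≤ n) (hs : 1 ≤ s) :
    minPebbleSteps n s ≤ minUnpebbleSteps n s := by
  obtain ⟨A, h1, h2⟩ := exists_minUnpebbleSteps hn hs
  rw [← h2]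
  exact (minPebbleSteps_le (h1.toPebbling hn)).trans (length_toPebbling_le n A)

theorem mul_invBinom_le_minPebbleSteps {n s : ℕ} (hn : 1 ≤ n) (hs : 1 ≤ s) :
    n * invBinom n s ≤ 32 * minPebbleSteps n s := by
  obtain ⟨A, h1, h2⟩ := exists_minPebbleSteps hn hs
  exact h2 ▸ h1.mul_invBinom_le hs

theorem length_optPebble_le {a n s : ℕ} (hn : 1 ≤ n) (hs : 1 ≤ s) :
    (optPebble a n s).length ≤ n * (2 * invBinom n s + 1) :=
  (length_toPebbling_le _ _).trans (length_optUnpebble s n hs hn a)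

theorem bound_le_minPebbleSteps {n s : ℕ} (hn : 1 ≤ n) (hs : 1 ≤ s) :
    n * (2 * invBinom n s + 1) ≤ 65 * minPebbleSteps n s := by
  have h1 := mul_invBinom_le_minPebbleSteps hn hs
  obtain ⟨A, h2, h3⟩ := exists_minPebbleSteps hn hs
  have h4 := h2.le_length
  rw [h3] at h4
  nlinarith

end SpookyPebble

/-- Lower bound at binomial lengths; `T(n, s) = Θ(n · B⁻¹(n, s))` uniformly in `n ≥ 2`, `s ≥ 1`;
correctness and asymptotic optimality of the explicit algorithms. -/
theorem mainTheorem1 :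
    (∃ c : ℝ, 0 < c ∧ ∀ n m s : ℕ, n = (m + s).choose m →
      c * ((n : ℝ) * (SpookyPebble.invBinom n s : ℝ)) ≤ (SpookyPebble.minPebbleSteps n s : ℝ)) ∧
    (∃ c C : ℝ, 0 < c ∧ 0 < C ∧ ∀ n s : ℕ, 2 ≤ n → 1 ≤ s →
      c * ((n : ℝ) * (SpookyPebble.invBinom n s : ℝ)) ≤ (SpookyPebble.minPebbleSteps n s : ℝ) ∧
      (SpookyPebble.minPebbleSteps n s : ℝ) ≤ C * ((n : ℝ) * (SpookyPebble.invBinom n s : ℝ))) ∧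
    (∀ a n s : ℕ, 1 ≤ n → 1 ≤ s →
      SpookyPebble.Unpebbles a (a + n) (s + 1) (SpookyPebble.optUnpebble a n s) ∧
      SpookyPebble.Pebbles a (a + n) (s + 2) (SpookyPebble.optPebble a n s)) ∧
    (∃ K : ℝ, 0 < K ∧ ∀ a n s : ℕ, 1 ≤ n → 1 ≤ s →
      ((SpookyPebble.optUnpebble a n s).length : ℝ) ≤
        K * (SpookyPebble.minUnpebbleSteps n s : ℝ) ∧
      ((SpookyPebble.optPebble a n s).length : ℝ) ≤
        K * (SpookyPebble.minPebbleSteps n s : ℝ)) := by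
  open SpookyPebble in
  have lower : ∀ n s : ℕ, 1 ≤ n → 1 ≤ s →
      1 / 32 * ((n : ℝ) * (invBinom n s : ℝ)) ≤ (minPebbleSteps n s : ℝ) := by
    intro n s hn hs
    have h : ((n * invBinom n s : ℕ) : ℝ) ≤ ((32 * minPebbleSteps n s : ℕ) : ℝ) :=
      Nat.cast_le.2 (mul_invBinom_le_minPebbleSteps hn hs)
    push_cast at h
    linarith
  open SpookyPebble in
  refine ⟨⟨1 / 32, by norm_num, ?_⟩, ⟨1 / 32, 3, by norm_num, by norm_num, ?_⟩,
    fun a n s hn hs => ⟨optUnpebble_unpebbles hn hs, optPebble_pebbles hn hs⟩,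
    ⟨65, by norm_num, ?_⟩⟩
  · rintro n m s hnm
    have hn : 1 ≤ n := hnm ▸ Nat.choose_pos (Nat.le_add_right m s)
    rcases Nat.eq_zero_or_pos s with rfl | hs
    -- For `s = 0` the binomial length is `1` and the left side vanishes.
    · have h0 : invBinom n 0 = 0 := Nat.le_zero.1 (invBinom_le (by simp [hnm]))
      simp [h0]
    · exact lower n s hn hs
  · intro n s hn hs
    refine ⟨lower n s (by omega) hs, ?_⟩
    have h1 := optPebble_pebbles (a := 0) (n := n) (s := s) (by omega) hs
    rw [zero_add] at h1
    have h2 := (minPebbleSteps_le h1).trans (length_optPebble_le (by omega) hs)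
    have h3 := one_le_invBinom hn hs
    have h4 : minPebbleSteps n s ≤ 3 * (n * invBinom n s) := by nlinarith
    exact_mod_cast h4
  · intro a n s hn hs
    have h1 := bound_le_minPebbleSteps hn hs
    have h2 := minPebbleSteps_le_minUnpebbleSteps hn hs
    have h3 := length_optUnpebble s n hs hn a
    have h4 := length_optPebble_le (a := a) hn hs
    have h5 : (optUnpebble a n s).length ≤ 65 * minUnpebbleSteps n s := by omega
    have h6 : (optPebble a n s).length ≤ 65 * minPebbleSteps n s := by omega
    exact ⟨by exact_mod_cast h5, by exact_mod_cast h6⟩
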